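/- Let $G$ be a Polish, locally compact abelian group (written additively) with Haar measure $\lambda$. For a $G$-valued random variable $X$ whose law has a density $f$ with respect to $\lambda$, let $h(X)=-\int_G f\log f\,d\lambda$ be its entropy (finite when $f\log f$ is $\lambda$-integrable), and for $G$-valued random variables $X,Y$ let $d_R(X\|Y)=h(\bar X-\bar Y)-h(\bar X)$ be the Ruzsa divergence, where $\bar X,\bar Y$ are independent with the same distributions as $X$ and $Y$ respectively. Let $X,X'$ be i.i.d. $G$-valued random variables such that $h(X)$, $h(X+X')$ and $h(X-X')$ are well defined and finite. Then $d_R(X\|-X)=h(X+X')-h(X)$, $d_R(X\|X)=h(X-X')-h(X)$, and $$\tfrac12\, d_R(X\|X)\;\le\; d_R(X\|-X)\;\le\; 2\, d_R(X\|X).$$ Consequently, whenever $d_R(X\|X)\neq 0$, $$\frac{d_R(X\|-X)}{d_R(X\|X)}=\frac{h(X+X')-h(X)}{h(X-X')-h(X)}\in\left[\tfrac12,\,2\right].$$ -/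

import Mathlib

open MeasureTheory ProbabilityTheory

namespace GroupEntropy

variable {Ω G : Type*} [MeasurableSpace Ω] [MeasurableSpace G]

/-- The entropy `h(X) = - ∫ f log f dν` (natural logarithm), where `f` is the density with respect
to the reference measure `ν` (a Haar measure on the group `G` in all uses) of the `G`-valued random
variable `X` on `(Ω, P)`. It is meaningful when `HasFiniteEntropy X P ν` holds. -/
noncomputable def entropy (X : Ω → G) (P : Measure Ω) (ν : Measure G) : ℝ :=
  - ∫ x, (pdf X P ν x).toReal * Real.log (pdf X P ν x).toReal ∂ν

/-- The entropy of `X` is well defined and finite: the law of `X` has a density `f` with respect to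
`ν`, and `f log f` is Lebesgue integrable. -/
structure HasFiniteEntropy (X : Ω → G) (P : Measure Ω) (ν : Measure G) : Prop where
  hasPDF : HasPDF X P ν
  integrable : Integrable
    (fun x => (pdf X P ν x).toReal * Real.log (pdf X P ν x).toReal) ν

/-- The Ruzsa divergence `d_R(X‖Y) = h(X' - Y') - h(X')`, where `X'` and `Y'` are independent with
the same distributions as `X` and `Y`: here they are the two coordinates on `G × G` under the
product of the law of `X` and the law of `Y`. -/
noncomputable def ruzsaDiv [Sub G] (X Y : Ω → G) (P : Measure Ω) (ν : Measure G) : ℝ :=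
  entropy (fun p : G × G => p.1 - p.2) ((P.map X).prod (P.map Y)) ν
    - entropy (fun p : G × G => p.1) ((P.map X).prod (P.map Y)) ν

end GroupEntropy

/-! For independent `X`, `Y`, `Z`, two inequalities carry the result. `entropy_sub_add_entropy_le`
is the triangle inequality h(X - Z) + h(Y) ≤ h(X + Y) + h(Y + Z); `entropy_add_add_entropy_le` is
h(X + Y) + h(Z) ≤ h(X - Z) + h(Y - Z). When all three have the same law, they bound h(X - X') + h(X)
by 2 h(X + X') and h(X + X') + h(X) by 2 h(X - X'): the lower and upper bounds.

The classical proofs pass through an intermediate entropy: h(X + Y, Y + Z) for the first, h(X + Y -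
Z) + h(Z) for the second. These may fail to be finite, so only their densities are used. Each
classical step becomes a statement that a likelihood ratio has expectation at most one, and
`integral_log_le_of_lintegral_div_le_one` chains two such ratios so that the intermediate density
cancels pointwise. -/

open scoped ENNReal

namespace GroupEntropy

/-! ### Jensen's inequality through an intermediate density. -/

/-- A chained form of Jensen's inequality for the logarithm: if the ratios `N / T` and `T / S` have
expectation at most one, then `𝔼[log N] ≤ 𝔼[log S]`. Nothing is assumed about `log T`. -/
lemma integral_log_le_of_lintegral_div_le_one {Ω : Type*} [MeasurableSpace Ω] {P : Measure Ω}
    [IsProbabilityMeasure P] {N T S : Ω → ℝ≥0∞}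
    (hN : Measurable N) (hT : Measurable T) (hS : Measurable S)
    (hN0 : ∀ᵐ ω ∂P, N ω ≠ 0) (hN' : ∀ᵐ ω ∂P, N ω ≠ ∞)
    (hS0 : ∀ᵐ ω ∂P, S ω ≠ 0) (hS' : ∀ᵐ ω ∂P, S ω ≠ ∞)
    (hNi : Integrable (fun ω => Real.log (N ω).toReal) P)
    (hSi : Integrable (fun ω => Real.log (S ω).toReal) P)
    (hNT : ∫⁻ ω, N ω / T ω ∂P ≤ 1) (hTS : ∫⁻ ω, T ω / S ω ∂P ≤ 1) :
    ∫ ω, Real.log (N ω).toReal ∂P ≤ ∫ ω, Real.log (S ω).toReal ∂P := by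
  have hNTm : Measurable fun ω => N ω / T ω := hN.div hT
  have hTSm : Measurable fun ω => T ω / S ω := hT.div hS
  have hNT_ae := ae_lt_top hNTm (hNT.trans_lt ENNReal.one_lt_top).ne
  have hTS_ae := ae_lt_top hTSm (hTS.trans_lt ENNReal.one_lt_top).ne
  have hNT_int : Integrable (fun ω => (N ω / T ω).toReal) P :=
    integrable_toReal_of_lintegral_ne_top hNTm.aemeasurable (hNT.trans_lt ENNReal.one_lt_top).ne
  have hTS_int : Integrable (fun ω => (T ω / S ω).toReal) P :=
    integrable_toReal_of_lintegral_ne_top hTSm.aemeasurable (hTS.trans_lt ENNReal.one_lt_top).ne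
  have hNT_le : ∫ ω, (N ω / T ω).toReal ∂P ≤ 1 := by
    rw [integral_toReal hNTm.aemeasurable hNT_ae]
    exact ENNReal.toReal_le_of_le_ofReal zero_le_one (by simpa using hNT)
  have hTS_le : ∫ ω, (T ω / S ω).toReal ∂P ≤ 1 := by
    rw [integral_toReal hTSm.aemeasurable hTS_ae]
    exact ENNReal.toReal_le_of_le_ofReal zero_le_one (by simpa using hTS)
  have key : ∀ᵐ ω ∂P, Real.log (N ω).toReal - Real.log (S ω).toReal
      ≤ (N ω / T ω).toReal + (T ω / S ω).toReal - 2 := by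
    filter_upwards [hN0, hN', hS0, hS', hNT_ae, hTS_ae] with ω h1 h2 h3 h4 h5 h6
    -- The value 0 or ∞ of `T` would make one of the two ratios infinite, which finite expectations
    -- exclude almost surely.
    have hT0 : T ω ≠ 0 := fun h => by simp [h, ENNReal.div_zero h1] at h5
    have hT' : T ω ≠ ∞ := fun h => by simp [h, ENNReal.top_div_of_ne_top h4] at h6
    have n := ENNReal.toReal_pos h1 h2
    have t := ENNReal.toReal_pos hT0 hT'
    have s := ENNReal.toReal_pos h3 h4
    -- When the two bounds log u ≤ u - 1 are added, log T cancels before any integration.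
    have e1 := Real.log_le_sub_one_of_pos (div_pos n t)
    have e2 := Real.log_le_sub_one_of_pos (div_pos t s)
    rw [Real.log_div n.ne' t.ne'] at e1
    rw [Real.log_div t.ne' s.ne'] at e2
    rw [ENNReal.toReal_div, ENNReal.toReal_div]
    linarith
  have := integral_mono_ae (hNi.sub hSi) ((hNT_int.add hTS_int).sub (integrable_const 2)) key
  simp only [Pi.sub_apply, Pi.add_apply] at this
  rw [integral_sub hNi hSi, integral_sub (by exact hNT_int.add hTS_int) (integrable_const 2),
    integral_add hNT_int hTS_int] at this
  simp only [integral_const, probReal_univ, smul_eq_mul, one_mul] at this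
  linarith

/-! ### Entropy as an expectation of log-densities. -/

section Entropy

variable {Ω Ω' G : Type*} [MeasurableSpace Ω] [MeasurableSpace Ω'] [MeasurableSpace G]
  {P : Measure Ω} {P' : Measure Ω'} {ν : Measure G} {X : Ω → G} {Y : Ω' → G}

lemma entropy_congr (h : P.map X = P'.map Y) : entropy X P ν = entropy Y P' ν := by
  simp only [entropy, pdf_def, h]

lemma HasFiniteEntropy.congr (hX : HasFiniteEntropy X P ν) (hY : AEMeasurable Y P')
    (h : P.map X = P'.map Y) : HasFiniteEntropy Y P' ν := by
  obtain ⟨hpdf, hint⟩ := hX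
  refine ⟨⟨hY, ?_, ?_⟩, ?_⟩
  · exact h ▸ hpdf.haveLebesgueDecomposition'
  · exact h ▸ hpdf.absolutelyContinuous'
  · simpa only [pdf_def, h] using hint

namespace HasFiniteEntropy

lemma ae_pdf_ne_zero (hX : HasFiniteEntropy X P ν) : ∀ᵐ ω ∂P, pdf X P ν (X ω) ≠ 0 := by
  have := hX.hasPDF
  have h := Measure.rnDeriv_pos hX.hasPDF.absolutelyContinuous'
  filter_upwards [ae_of_ae_map (HasPDF.aemeasurable X P ν) h] with ω hω using hω.ne'

lemma ae_pdf_ne_top [IsFiniteMeasure P] (hX : HasFiniteEntropy X P ν) :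
    ∀ᵐ ω ∂P, pdf X P ν (X ω) ≠ ∞ := by
  have := hX.hasPDF
  have h := hX.hasPDF.absolutelyContinuous'.ae_le (Measure.rnDeriv_lt_top (P.map X) ν)
  filter_upwards [ae_of_ae_map (HasPDF.aemeasurable X P ν) h] with ω hω using hω.ne

lemma integrable_log_pdf [IsFiniteMeasure P] (hX : HasFiniteEntropy X P ν) :
    Integrable (fun ω => Real.log (pdf X P ν (X ω)).toReal) P := by
  have := hX.hasPDF
  refine (pdf.integrable_pdf_smul_iff (μ := ν)
    (f := fun x => Real.log (pdf X P ν x).toReal) ?_).1 hX.integrable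
  exact (measurable_pdf X P ν).ennreal_toReal.log.aestronglyMeasurable

lemma integral_log_pdf [IsFiniteMeasure P] (hX : HasFiniteEntropy X P ν) :
    ∫ ω, Real.log (pdf X P ν (X ω)).toReal ∂P = - entropy X P ν := by
  have := hX.hasPDF
  rw [entropy, neg_neg]
  refine (pdf.integral_pdf_smul (μ := ν)
    (f := fun x => Real.log (pdf X P ν x).toReal) ?_).symm
  exact (measurable_pdf X P ν).ennreal_toReal.log.aestronglyMeasurable

end HasFiniteEntropy

/-- A criterion for `h(C) + h(D) ≤ h(A) + h(B)`, with `A`, `B`, `C`, `D` on one probability space: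
the product of the densities of `A` and `B` is compared to that of `C` and `D` through some `T`. -/
lemma entropy_add_le_of_lintegral_div_le_one {P : Measure Ω} [IsProbabilityMeasure P]
    {A B C D : Ω → G} (mA : Measurable A) (mB : Measurable B) (mC : Measurable C)
    (mD : Measurable D)
    (hA : HasFiniteEntropy A P ν) (hB : HasFiniteEntropy B P ν)
    (hC : HasFiniteEntropy C P ν) (hD : HasFiniteEntropy D P ν)
    {T : Ω → ℝ≥0∞} (hT : Measurable T)
    (h₁ : ∫⁻ ω, pdf A P ν (A ω) * pdf B P ν (B ω) / T ω ∂P ≤ 1)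
    (h₂ : ∫⁻ ω, T ω / (pdf C P ν (C ω) * pdf D P ν (D ω)) ∂P ≤ 1) :
    entropy C P ν + entropy D P ν ≤ entropy A P ν + entropy B P ν := by
  have split : ∀ {U V : Ω → G}, HasFiniteEntropy U P ν → HasFiniteEntropy V P ν →
      (fun ω => Real.log (pdf U P ν (U ω) * pdf V P ν (V ω)).toReal) =ᵐ[P]
      fun ω => Real.log (pdf U P ν (U ω)).toReal + Real.log (pdf V P ν (V ω)).toReal := by
    intro U V hU hV
    filter_upwards [hU.ae_pdf_ne_zero, hU.ae_pdf_ne_top, hV.ae_pdf_ne_zero, hV.ae_pdf_ne_top]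
      with ω a b c d
    rw [ENNReal.toReal_mul, Real.log_mul (ENNReal.toReal_pos a b).ne'
      (ENNReal.toReal_pos c d).ne']
  have h := integral_log_le_of_lintegral_div_le_one (P := P)
    (N := fun ω => pdf A P ν (A ω) * pdf B P ν (B ω)) (T := T)
    (S := fun ω => pdf C P ν (C ω) * pdf D P ν (D ω)) (by fun_prop) hT (by fun_prop)
    (by filter_upwards [hA.ae_pdf_ne_zero, hB.ae_pdf_ne_zero] with ω a b using mul_ne_zero a b)
    (by filter_upwards [hA.ae_pdf_ne_top, hB.ae_pdf_ne_top] with ω a b using ENNReal.mul_ne_top a b)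
    (by filter_upwards [hC.ae_pdf_ne_zero, hD.ae_pdf_ne_zero] with ω a b using mul_ne_zero a b)
    (by filter_upwards [hC.ae_pdf_ne_top, hD.ae_pdf_ne_top] with ω a b using ENNReal.mul_ne_top a b)
    ((hA.integrable_log_pdf.add hB.integrable_log_pdf).congr (split hA hB).symm)
    ((hC.integrable_log_pdf.add hD.integrable_log_pdf).congr (split hC hD).symm) h₁ h₂
  rw [integral_congr_ae (split hA hB), integral_congr_ae (split hC hD),
    integral_add hA.integrable_log_pdf hB.integrable_log_pdf,
    integral_add hC.integrable_log_pdf hD.integrable_log_pdf, hA.integral_log_pdf,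
    hB.integral_log_pdf, hC.integral_log_pdf, hD.integral_log_pdf] at h
  linarith

end Entropy

/-- This cancels the density of the variable being integrated out. Equality can fail where that
density is 0 or ∞, but an upper bound is all that is needed. -/
lemma mul_div_mul_right_le (a b c : ℝ≥0∞) : b * (a / (c * b)) ≤ a / c := by
  have h : b * (c * b)⁻¹ ≤ c⁻¹ := by
    rcases eq_or_ne b 0 with rfl | h0
    · simp
    rcases eq_or_ne b ∞ with rfl | h1
    · rcases eq_or_ne c 0 with rfl | hc
      · simp
      · simp [ENNReal.mul_top hc]
    rw [ENNReal.mul_inv (Or.inr h1) (Or.inr h0), mul_left_comm, ENNReal.mul_inv_cancel h0 h1,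
      mul_one]
  calc b * (a / (c * b)) = a * (b * (c * b)⁻¹) := by rw [div_eq_mul_inv, mul_left_comm]
    _ ≤ a / c := by rw [div_eq_mul_inv]; gcongr

/-! ### The two entropy inequalities for independent triples. -/

section Triples

variable {G : Type*} [AddCommGroup G] [MeasurableSpace G] [MeasurableAdd₂ G] [MeasurableNeg G]
  {ν : Measure G} [SigmaFinite ν] [ν.IsAddLeftInvariant]
  {μ₁ μ₂ μ₃ : Measure G} [IsProbabilityMeasure μ₁] [IsProbabilityMeasure μ₂]
  [IsProbabilityMeasure μ₃]

/-- For independent `X`, `Y`, `Z` such that `X` and `Z` have densities `f`, `g`, the pair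
`(X + Y, Y + Z)` has the joint density `(a, b) ↦ 𝔼[f (a - Y) * g (b - Y)]`. -/
lemma lintegral_add_add_eq (h₁ : μ₁ ≪ ν) (h₃ : μ₃ ≪ ν) {N : G × G → ℝ≥0∞} (hN : Measurable N) :
    ∫⁻ p, N (p.1 + p.2.1, p.2.1 + p.2.2) ∂(μ₁.prod (μ₂.prod μ₃))
      = ∫⁻ z, (∫⁻ x, μ₁.rnDeriv ν (z.1 - x) * μ₃.rnDeriv ν (z.2 - x) ∂μ₂) * N z
          ∂(ν.prod ν) := by
  have m₁ := Measure.measurable_rnDeriv μ₁ ν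
  have m₃ := Measure.measurable_rnDeriv μ₃ ν
  -- With the middle variable frozen at `x`, translation invariance of `ν` turns the shifted
  -- densities back into integrals against `μ₁` and `μ₃`.
  have inner (x : G) : ∫⁻ z, μ₁.rnDeriv ν (z.1 - x) * μ₃.rnDeriv ν (z.2 - x) * N z ∂(ν.prod ν)
      = ∫⁻ a, ∫⁻ b, N (a + x, x + b) ∂μ₃ ∂μ₁ := by
    rw [lintegral_prod _ (by fun_prop), ← lintegral_rnDeriv_mul h₁
      (Measurable.lintegral_prod_right' (f := fun q : G × G => N (q.1 + x, x + q.2))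
        (by fun_prop)).aemeasurable, ← lintegral_add_right_eq_self _ x]
    refine lintegral_congr fun a => ?_
    rw [← lintegral_rnDeriv_mul h₃ (by fun_prop), ← lintegral_const_mul _ (by fun_prop),
      ← lintegral_add_left_eq_self _ x]
    refine lintegral_congr fun b => ?_
    simp only [add_sub_cancel_right, add_sub_cancel_left, mul_assoc]
  calc ∫⁻ p, N (p.1 + p.2.1, p.2.1 + p.2.2) ∂(μ₁.prod (μ₂.prod μ₃))
      = ∫⁻ a, ∫⁻ x, ∫⁻ b, N (a + x, x + b) ∂μ₃ ∂μ₂ ∂μ₁ := by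
        rw [lintegral_prod _ (by fun_prop)]
        refine lintegral_congr fun a => ?_
        rw [lintegral_prod _ (by fun_prop)]
    _ = ∫⁻ x, ∫⁻ a, ∫⁻ b, N (a + x, x + b) ∂μ₃ ∂μ₁ ∂μ₂ := by
        refine lintegral_lintegral_swap (Measurable.aemeasurable ?_)
        exact Measurable.lintegral_prod_right'
          (f := fun q : (G × G) × G => N (q.1.1 + q.1.2, q.1.2 + q.2)) (by fun_prop)
    _ = ∫⁻ x, ∫⁻ z, μ₁.rnDeriv ν (z.1 - x) * μ₃.rnDeriv ν (z.2 - x) * N z ∂(ν.prod ν) ∂μ₂ :=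
        lintegral_congr fun x => (inner x).symm
    _ = ∫⁻ z, ∫⁻ x, μ₁.rnDeriv ν (z.1 - x) * μ₃.rnDeriv ν (z.2 - x) * N z ∂μ₂ ∂(ν.prod ν) :=
        lintegral_lintegral_swap (by fun_prop)
    _ = _ := lintegral_congr fun z => lintegral_mul_const _ (by fun_prop)

/-- The Ruzsa triangle inequality: `h(X - Z) + h(Y) ≤ h(X + Y) + h(Y + Z)` for independent
`X`, `Y`, `Z`, here the coordinates under a product measure. -/
theorem entropy_sub_add_entropy_le (h₁ : μ₁ ≪ ν) (h₃ : μ₃ ≪ ν)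
    (hsub : HasFiniteEntropy (fun p : G × G × G => p.1 - p.2.2) (μ₁.prod (μ₂.prod μ₃)) ν)
    (hmid : HasFiniteEntropy (fun p : G × G × G => p.2.1) (μ₁.prod (μ₂.prod μ₃)) ν)
    (hadd : HasFiniteEntropy (fun p : G × G × G => p.1 + p.2.1) (μ₁.prod (μ₂.prod μ₃)) ν)
    (hadd' : HasFiniteEntropy (fun p : G × G × G => p.2.1 + p.2.2) (μ₁.prod (μ₂.prod μ₃)) ν) :
    entropy (fun p : G × G × G => p.1 - p.2.2) (μ₁.prod (μ₂.prod μ₃)) ν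
        + entropy (fun p : G × G × G => p.2.1) (μ₁.prod (μ₂.prod μ₃)) ν
      ≤ entropy (fun p : G × G × G => p.1 + p.2.1) (μ₁.prod (μ₂.prod μ₃)) ν
        + entropy (fun p : G × G × G => p.2.1 + p.2.2) (μ₁.prod (μ₂.prod μ₃)) ν := by
  have m₁ := Measure.measurable_rnDeriv μ₁ ν
  have m₃ := Measure.measurable_rnDeriv μ₃ ν
  set q : G × G → ℝ≥0∞ := fun z =>
    ∫⁻ x, μ₁.rnDeriv ν (z.1 - x) * μ₃.rnDeriv ν (z.2 - x) ∂μ₂ with hq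
  have mq : Measurable q := Measurable.lintegral_prod_right'
    (f := fun r : (G × G) × G => μ₁.rnDeriv ν (r.1.1 - r.2) * μ₃.rnDeriv ν (r.1.2 - r.2))
    (by fun_prop)
  have := hsub.hasPDF
  have := hmid.hasPDF
  have := hadd.hasPDF
  have := hadd'.hasPDF
  set Q := μ₁.prod (μ₂.prod μ₃) with hQ
  set s := pdf (fun p : G × G × G => p.1 + p.2.1) Q ν
  set r := pdf (fun p : G × G × G => p.2.1 + p.2.2) Q ν
  set d := pdf (fun p : G × G × G => p.1 - p.2.2) Q ν with hd
  set f := pdf (fun p : G × G × G => p.2.1) Q ν with hf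
  have ms : Measurable s := measurable_pdf _ _ _
  have mr : Measurable r := measurable_pdf _ _ _
  have md : Measurable d := measurable_pdf _ _ _
  have mf : Measurable f := measurable_pdf _ _ _
  refine entropy_add_le_of_lintegral_div_le_one (by fun_prop) (by fun_prop) (by fun_prop)
    (by fun_prop) hadd hadd' hsub hmid (T := fun p => q (p.1 + p.2.1, p.2.1 + p.2.2))
    (by fun_prop) ?_ ?_
  -- Subadditivity: the product of the marginal densities is compared with the joint density `q`.
  · rw [lintegral_add_add_eq (μ₁ := μ₁) (μ₂ := μ₂) (μ₃ := μ₃) (ν := ν) h₁ h₃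
      (N := fun z => s z.1 * r z.2 / q z) (by fun_prop)]
    calc ∫⁻ z, q z * (s z.1 * r z.2 / q z) ∂(ν.prod ν)
        ≤ ∫⁻ z, s z.1 * r z.2 ∂(ν.prod ν) := lintegral_mono fun z => ENNReal.mul_div_le
      _ = 1 := by
        rw [lintegral_prod_mul ms.aemeasurable mr.aemeasurable, pdf.lintegral_eq_measure_univ,
          pdf.lintegral_eq_measure_univ, measure_univ, one_mul]
  · -- the density of `X - Z`
    set k : G → ℝ≥0∞ := fun w => ∫⁻ y, μ₁.rnDeriv ν (w + y) * μ₃.rnDeriv ν y ∂ν with hk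
    have mk : Measurable k := Measurable.lintegral_prod_right'
      (f := fun u : G × G => μ₁.rnDeriv ν (u.1 + u.2) * μ₃.rnDeriv ν u.2) (by fun_prop)
    -- Total mass one suffices: `k` need not be identified with `d`.
    have hk1 : ∫⁻ w, k w ∂ν = 1 := by
      rw [hk, lintegral_lintegral_swap (by fun_prop)]
      have (y : G) : ∫⁻ w, μ₁.rnDeriv ν (w + y) * μ₃.rnDeriv ν y ∂ν = μ₃.rnDeriv ν y := by
        rw [lintegral_mul_const _ (by fun_prop), lintegral_add_right_eq_self,
          Measure.lintegral_rnDeriv h₁, measure_univ, one_mul]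
      simp_rw [this]
      rw [Measure.lintegral_rnDeriv h₃, measure_univ]
    have hqk (w : G) : ∫⁻ y, q (w + y, y) ∂ν = k w := by
      rw [hq, lintegral_lintegral_swap (by fun_prop)]
      have (x : G) : ∫⁻ y, μ₁.rnDeriv ν (w + y - x) * μ₃.rnDeriv ν (y - x) ∂ν = k w := by
        rw [← lintegral_add_right_eq_self _ x, hk]
        refine lintegral_congr fun y => ?_
        rw [add_sub_cancel_right, ← add_assoc, add_sub_cancel_right]
      simp only [this, lintegral_const, measure_univ, mul_one]
    have hf2 : μ₂ = ν.withDensity f := by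
      rw [hf, ← map_eq_withDensity_pdf _ _ ν, hQ]
      refine Eq.trans ?_ (Measure.map_map (g := Prod.fst) (f := Prod.snd)
        measurable_fst measurable_snd)
      simp
    -- Conditioning on `X` and `Z`: as `y` varies, (x + y, y + z) runs along the fibre of the
    -- difference map over x - z, where `q` integrates to `k`.
    have mid (x z : G) : ∫⁻ y, q (x + y, y + z) / (d (x - z) * f y) ∂μ₂
        ≤ k (x - z) / d (x - z) := by
      rw [hf2, lintegral_withDensity_eq_lintegral_mul _ mf (by fun_prop)]
      calc ∫⁻ y, f y * (q (x + y, y + z) / (d (x - z) * f y)) ∂ν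
          ≤ ∫⁻ y, q (x + y, y + z) / d (x - z) ∂ν := by
            exact lintegral_mono fun y => mul_div_mul_right_le _ _ _
        _ = (∫⁻ y, q (x - z + (y + z), y + z) ∂ν) / d (x - z) := by
            simp only [div_eq_mul_inv]
            rw [lintegral_mul_const _ (by fun_prop)]
            congr 2 with y
            congr 2
            abel
        _ = _ := by rw [lintegral_add_right_eq_self (fun y => q (x - z + y, y)), hqk]
    calc ∫⁻ p, q (p.1 + p.2.1, p.2.1 + p.2.2) / (d (p.1 - p.2.2) * f p.2.1) ∂Q
        = ∫⁻ x, ∫⁻ z, ∫⁻ y, q (x + y, y + z) / (d (x - z) * f y) ∂μ₂ ∂μ₃ ∂μ₁ := by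
          rw [hQ, lintegral_prod _ (by fun_prop)]
          refine lintegral_congr fun x => ?_
          rw [lintegral_prod_symm _ (by fun_prop)]
      _ ≤ ∫⁻ x, ∫⁻ z, k (x - z) / d (x - z) ∂μ₃ ∂μ₁ :=
          lintegral_mono fun x => lintegral_mono fun z => mid x z
      _ = ∫⁻ p, k (p.1 - p.2.2) / d (p.1 - p.2.2) ∂Q := by
          rw [hQ, lintegral_prod _ (by fun_prop)]
          refine lintegral_congr fun x => ?_
          rw [lintegral_prod_symm _ (by fun_prop)]
          simp
      _ = ∫⁻ w, d w * (k w / d w) ∂ν :=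
          (pdf.lintegral_pdf_mul (X := fun p : G × G × G => p.1 - p.2.2)
            (f := fun w => k w / d w) (by fun_prop)).symm
      _ ≤ ∫⁻ w, k w ∂ν := lintegral_mono fun w => ENNReal.mul_div_le
      _ = 1 := hk1

/-- Submodularity combined with monotonicity of entropy under independent sums:
`h(X + Y) + h(Z) ≤ h(X - Z) + h(Y - Z)` for independent `X`, `Y`, `Z`, here the coordinates under a
product measure. -/
theorem entropy_add_add_entropy_le [ν.IsNegInvariant]
    (hadd : HasFiniteEntropy (fun p : G × G × G => p.1 + p.2.1) (μ₁.prod (μ₂.prod μ₃)) ν)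
    (hlast : HasFiniteEntropy (fun p : G × G × G => p.2.2) (μ₁.prod (μ₂.prod μ₃)) ν)
    (hsub : HasFiniteEntropy (fun p : G × G × G => p.1 - p.2.2) (μ₁.prod (μ₂.prod μ₃)) ν)
    (hsub' : HasFiniteEntropy (fun p : G × G × G => p.2.1 - p.2.2) (μ₁.prod (μ₂.prod μ₃)) ν) :
    entropy (fun p : G × G × G => p.1 + p.2.1) (μ₁.prod (μ₂.prod μ₃)) ν
        + entropy (fun p : G × G × G => p.2.2) (μ₁.prod (μ₂.prod μ₃)) ν
      ≤ entropy (fun p : G × G × G => p.1 - p.2.2) (μ₁.prod (μ₂.prod μ₃)) ν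
        + entropy (fun p : G × G × G => p.2.1 - p.2.2) (μ₁.prod (μ₂.prod μ₃)) ν := by
  have := hadd.hasPDF
  have := hlast.hasPDF
  have := hsub.hasPDF
  have := hsub'.hasPDF
  set Q := μ₁.prod (μ₂.prod μ₃) with hQ
  set s := pdf (fun p : G × G × G => p.1 + p.2.1) Q ν
  set f := pdf (fun p : G × G × G => p.2.2) Q ν with hf
  set d := pdf (fun p : G × G × G => p.1 - p.2.2) Q ν
  set e := pdf (fun p : G × G × G => p.2.1 - p.2.2) Q ν
  have ms : Measurable s := measurable_pdf _ _ _
  have mf : Measurable f := measurable_pdf _ _ _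
  have md : Measurable d := measurable_pdf _ _ _
  have me : Measurable e := measurable_pdf _ _ _
  have hd1 : ∫⁻ w, d w ∂ν = 1 := by rw [pdf.lintegral_eq_measure_univ, measure_univ]
  have he1 : ∫⁻ w, e w ∂ν = 1 := by rw [pdf.lintegral_eq_measure_univ, measure_univ]
  -- the density of `X + Y - Z`
  set t : G → ℝ≥0∞ := fun v => ∫⁻ x, e (v - x) ∂μ₁ with ht
  have mt : Measurable t := Measurable.lintegral_prod_right'
    (f := fun u : G × G => e (u.1 - u.2)) (by fun_prop)
  have ht1 : ∫⁻ v, t v ∂ν = 1 := by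
    rw [ht, lintegral_lintegral_swap (by fun_prop)]
    simp only [lintegral_sub_right_eq_self, he1, lintegral_const, measure_univ, mul_one]
  have hf3 : μ₃ = ν.withDensity f := by
    rw [hf, ← map_eq_withDensity_pdf _ _ ν, hQ]
    refine Eq.trans ?_ (Measure.map_map (g := Prod.snd) (f := Prod.snd)
      measurable_snd measurable_snd)
    simp
  refine entropy_add_le_of_lintegral_div_le_one (by fun_prop) (by fun_prop) (by fun_prop)
    (by fun_prop) hsub hsub' hadd hlast
    (T := fun p => t (p.1 + p.2.1 - p.2.2) * f p.2.2) (by fun_prop) ?_ ?_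
  -- Submodularity: integrating out z and substituting w = x - z leaves `x` only in `e (w + y - x)`,
  -- whose `μ₁`-average is `t (w + y)` and cancels the denominator.
  · have last (x y : G) :
        ∫⁻ z, d (x - z) * e (y - z) / (t (x + y - z) * f z) ∂μ₃
          ≤ ∫⁻ w, d w * e (w + y - x) / t (w + y) ∂ν := by
      rw [hf3, lintegral_withDensity_eq_lintegral_mul _ mf (by fun_prop)]
      rw [← lintegral_sub_left_eq_self (fun w => d w * e (w + y - x) / t (w + y)) x]
      refine lintegral_mono fun z => ?_
      have e1 : x + y - z - x = y - z := by abel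
      have e2 : x - z + y = x + y - z := by abel
      simp only [Pi.mul_apply, e2, e1]
      exact mul_div_mul_right_le _ _ _
    calc ∫⁻ p, d (p.1 - p.2.2) * e (p.2.1 - p.2.2)
            / (t (p.1 + p.2.1 - p.2.2) * f p.2.2) ∂Q
        = ∫⁻ x, ∫⁻ y, ∫⁻ z, d (x - z) * e (y - z) / (t (x + y - z) * f z) ∂μ₃ ∂μ₂ ∂μ₁ := by
          rw [hQ, lintegral_prod _ (by fun_prop)]
          refine lintegral_congr fun x => ?_
          rw [lintegral_prod _ (by fun_prop)]
      _ ≤ ∫⁻ x, ∫⁻ y, ∫⁻ w, d w * e (w + y - x) / t (w + y) ∂ν ∂μ₂ ∂μ₁ :=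
          lintegral_mono fun x => lintegral_mono fun y => last x y
      _ = ∫⁻ y, ∫⁻ w, ∫⁻ x, d w * e (w + y - x) / t (w + y) ∂μ₁ ∂ν ∂μ₂ := by
          rw [lintegral_lintegral_swap (Measurable.aemeasurable <|
            Measurable.lintegral_prod_right' (f := fun u : (G × G) × G =>
              d u.2 * e (u.2 + u.1.2 - u.1.1) / t (u.2 + u.1.2)) (by fun_prop))]
          refine lintegral_congr fun y => ?_
          rw [lintegral_lintegral_swap (by fun_prop)]
      _ ≤ ∫⁻ y, ∫⁻ w, d w ∂ν ∂μ₂ := by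
          refine lintegral_mono fun y => lintegral_mono fun w => ?_
          calc ∫⁻ x, d w * e (w + y - x) / t (w + y) ∂μ₁
              = d w * (t (w + y) / t (w + y)) := by
                simp only [div_eq_mul_inv, mul_assoc]
                rw [lintegral_const_mul _ (by fun_prop), lintegral_mul_const _ (by fun_prop)]
            _ ≤ d w * 1 := by gcongr; exact ENNReal.div_self_le_one
            _ = d w := mul_one _
      _ = 1 := by simp [hd1]
  -- Monotonicity h(X + Y) ≤ h(X + Y - Z): for frozen z the ratio integrates to at most the mass of
  -- a translate of `t`.
  · have inner : ∀ᵐ p ∂Q, t (p.1 + p.2.1 - p.2.2) * f p.2.2 / (s (p.1 + p.2.1) * f p.2.2)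
        = t (p.1 + p.2.1 - p.2.2) / s (p.1 + p.2.1) := by
      filter_upwards [hlast.ae_pdf_ne_zero, hlast.ae_pdf_ne_top] with p h0 h1
      exact ENNReal.mul_div_mul_right _ _ h0 h1
    calc ∫⁻ p, t (p.1 + p.2.1 - p.2.2) * f p.2.2 / (s (p.1 + p.2.1) * f p.2.2) ∂Q
        = ∫⁻ p, t (p.1 + p.2.1 - p.2.2) / s (p.1 + p.2.1) ∂Q := lintegral_congr_ae inner
      _ = ∫⁻ z, ∫⁻ x, ∫⁻ y, t (x + y - z) / s (x + y) ∂μ₂ ∂μ₁ ∂μ₃ := by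
          have (x : G) : ∫⁻ u, t (x + u.1 - u.2) / s (x + u.1) ∂(μ₂.prod μ₃)
              = ∫⁻ z, ∫⁻ y, t (x + y - z) / s (x + y) ∂μ₂ ∂μ₃ :=
            lintegral_prod_symm _ (by fun_prop)
          rw [hQ, lintegral_prod _ (by fun_prop)]
          simp only [this]
          rw [lintegral_lintegral_swap (Measurable.aemeasurable <|
            Measurable.lintegral_prod_right' (f := fun u : (G × G) × G =>
              t (u.1.1 + u.2 - u.1.2) / s (u.1.1 + u.2)) (by fun_prop))]
      _ = ∫⁻ z, ∫⁻ p, t (p.1 + p.2.1 - z) / s (p.1 + p.2.1) ∂Q ∂μ₃ := by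
          refine lintegral_congr fun z => ?_
          rw [hQ, lintegral_prod _ (by fun_prop)]
          refine lintegral_congr fun x => ?_
          rw [lintegral_prod _ (by fun_prop)]
          simp
      _ ≤ ∫⁻ z, 1 ∂μ₃ := by
          refine lintegral_mono fun z => ?_
          calc ∫⁻ p, t (p.1 + p.2.1 - z) / s (p.1 + p.2.1) ∂Q
              = ∫⁻ w, s w * (t (w - z) / s w) ∂ν :=
                (pdf.lintegral_pdf_mul (X := fun p : G × G × G => p.1 + p.2.1)
                  (f := fun w => t (w - z) / s w) (by fun_prop)).symm
            _ ≤ ∫⁻ w, t (w - z) ∂ν := lintegral_mono fun w => ENNReal.mul_div_le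
            _ = 1 := by rw [lintegral_sub_right_eq_self, ht1]
      _ = 1 := by simp

end Triples

/-! ### Laws of the sum and difference of an i.i.d. pair. -/

section Laws

variable {Ω G : Type*} [MeasurableSpace Ω] [MeasurableSpace G] [AddCommGroup G]
  {P : Measure Ω} [IsProbabilityMeasure P] {X X' : Ω → G}

lemma map_add_eq_of_indepFun [MeasurableAdd₂ G] (hX : Measurable X) (hX' : Measurable X')
    (hindep : IndepFun X X' P) (hident : IdentDistrib X X' P P) :
    P.map (fun ω => X ω + X' ω) = ((P.map X).prod (P.map X)).map fun p => p.1 + p.2 := by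
  have h := (indepFun_iff_map_prod_eq_prod_map_map hX.aemeasurable hX'.aemeasurable).1 hindep
  rw [← hident.map_eq] at h
  rw [← h, Measure.map_map (by fun_prop) (by fun_prop)]
  rfl

lemma map_sub_eq_of_indepFun [MeasurableSub₂ G] (hX : Measurable X) (hX' : Measurable X')
    (hindep : IndepFun X X' P) (hident : IdentDistrib X X' P P) :
    P.map (fun ω => X ω - X' ω) = ((P.map X).prod (P.map X)).map fun p => p.1 - p.2 := by
  have h := (indepFun_iff_map_prod_eq_prod_map_map hX.aemeasurable hX'.aemeasurable).1 hindep
  rw [← hident.map_eq] at h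
  rw [← h, Measure.map_map (by fun_prop) (by fun_prop)]
  rfl

end Laws

/-! ### Two-variable laws viewed inside a triple product. -/

section Pairs

variable {α β : Type*} [MeasurableSpace α] [MeasurableSpace β] {μ : Measure α}
  [IsProbabilityMeasure μ]

lemma map_prod_prod_fst_snd_fst (φ : α × α → β) (hφ : Measurable φ) :
    (μ.prod (μ.prod μ)).map (fun p => φ (p.1, p.2.1)) = (μ.prod μ).map φ := by
  have h : (μ.prod (μ.prod μ)).map (Prod.map id Prod.fst) = μ.prod μ := by
    rw [← Measure.map_prod_map _ _ measurable_id measurable_fst]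
    simp
  conv_rhs => rw [← h]
  rw [Measure.map_map hφ (by fun_prop)]
  rfl

lemma map_prod_prod_fst_snd_snd (φ : α × α → β) (hφ : Measurable φ) :
    (μ.prod (μ.prod μ)).map (fun p => φ (p.1, p.2.2)) = (μ.prod μ).map φ := by
  have h : (μ.prod (μ.prod μ)).map (Prod.map id Prod.snd) = μ.prod μ := by
    rw [← Measure.map_prod_map _ _ measurable_id measurable_snd]
    simp
  conv_rhs => rw [← h]
  rw [Measure.map_map hφ (by fun_prop)]
  rfl

lemma map_prod_prod_snd (φ : α × α → β) (hφ : Measurable φ) :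
    (μ.prod (μ.prod μ)).map (fun p => φ p.2) = (μ.prod μ).map φ := by
  refine (Measure.map_map (g := φ) (f := Prod.snd) hφ measurable_snd).symm.trans ?_
  simp

end Pairs

end GroupEntropy

/-! ### The bounds for an i.i.d. pair. -/

theorem corollary4p3 {G : Type*} [AddCommGroup G] [TopologicalSpace G] [IsTopologicalAddGroup G]
    [PolishSpace G] [LocallyCompactSpace G] [MeasurableSpace G] [BorelSpace G]
    (ν : Measure G) [ν.IsAddHaarMeasure]
    {Ω : Type*} [MeasurableSpace Ω] (P : Measure Ω) [IsProbabilityMeasure P]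
    (X X' : Ω → G) (hX : Measurable X) (hX' : Measurable X')
    (hindep : IndepFun X X' P) (hident : IdentDistrib X X' P P)
    (hfin : GroupEntropy.HasFiniteEntropy X P ν)
    (hfin_add : GroupEntropy.HasFiniteEntropy (fun ω => X ω + X' ω) P ν)
    (hfin_sub : GroupEntropy.HasFiniteEntropy (fun ω => X ω - X' ω) P ν) :
    -- the two divergences are the two entropy differences
    GroupEntropy.ruzsaDiv X (fun ω => -X ω) P ν
        = GroupEntropy.entropy (fun ω => X ω + X' ω) P ν - GroupEntropy.entropy X P ν ∧
    GroupEntropy.ruzsaDiv X X P ν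
        = GroupEntropy.entropy (fun ω => X ω - X' ω) P ν - GroupEntropy.entropy X P ν ∧
    -- the two-sided bound, free of division
    (1 / 2 : ℝ) * GroupEntropy.ruzsaDiv X X P ν
        ≤ GroupEntropy.ruzsaDiv X (fun ω => -X ω) P ν ∧
    GroupEntropy.ruzsaDiv X (fun ω => -X ω) P ν ≤ 2 * GroupEntropy.ruzsaDiv X X P ν ∧
    -- the ratio of the divergences
    (GroupEntropy.ruzsaDiv X X P ν ≠ 0 →
      GroupEntropy.ruzsaDiv X (fun ω => -X ω) P ν / GroupEntropy.ruzsaDiv X X P ν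
        ∈ Set.Icc (1 / 2 : ℝ) 2) ∧
    -- the ratio of the entropy differences
    (GroupEntropy.entropy (fun ω => X ω - X' ω) P ν - GroupEntropy.entropy X P ν ≠ 0 →
      (GroupEntropy.entropy (fun ω => X ω + X' ω) P ν - GroupEntropy.entropy X P ν)
          / (GroupEntropy.entropy (fun ω => X ω - X' ω) P ν - GroupEntropy.entropy X P ν)
        ∈ Set.Icc (1 / 2 : ℝ) 2) := by
  have hX2 : IsProbabilityMeasure (P.map X) := Measure.isProbabilityMeasure_map hX.aemeasurable
  have hadd_law := GroupEntropy.map_add_eq_of_indepFun hX hX' hindep hident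
  have hsub_law := GroupEntropy.map_sub_eq_of_indepFun hX hX' hindep hident
  have hfst : ((P.map X).prod (P.map X)).map (fun p : G × G => p.1) = P.map X := by
    simp
  have hsnd : ((P.map X).prod (P.map X)).map (fun p : G × G => p.2) = P.map X := by
    simp
  have hneg : (P.map X).prod (P.map fun ω => -X ω)
      = ((P.map X).prod (P.map X)).map (Prod.map id fun x => -x) := by
    rw [← Measure.map_prod_map _ _ measurable_id measurable_neg, Measure.map_id,
      Measure.map_map measurable_neg hX]
    rfl
  have hdiv_neg : GroupEntropy.ruzsaDiv X (fun ω => -X ω) P ν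
      = GroupEntropy.entropy (fun ω => X ω + X' ω) P ν - GroupEntropy.entropy X P ν := by
    rw [GroupEntropy.ruzsaDiv, hneg]
    congr 1
    · refine GroupEntropy.entropy_congr ?_
      rw [hadd_law, Measure.map_map (by fun_prop) (by fun_prop)]
      congr 1
      ext p
      simp
    · refine GroupEntropy.entropy_congr ?_
      rw [Measure.map_map (by fun_prop) (by fun_prop), ← hfst]
      congr 1
      simp
  have hdiv : GroupEntropy.ruzsaDiv X X P ν
      = GroupEntropy.entropy (fun ω => X ω - X' ω) P ν - GroupEntropy.entropy X P ν := by
    rw [GroupEntropy.ruzsaDiv, GroupEntropy.entropy_congr hsub_law.symm,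
      GroupEntropy.entropy_congr hfst]
  have hadd12 := hadd_law.trans (GroupEntropy.map_prod_prod_fst_snd_fst _ (by fun_prop)).symm
  have hadd23 := hadd_law.trans (GroupEntropy.map_prod_prod_snd _ (by fun_prop)).symm
  have hsub13 := hsub_law.trans (GroupEntropy.map_prod_prod_fst_snd_snd _ (by fun_prop)).symm
  have hsub23 := hsub_law.trans (GroupEntropy.map_prod_prod_snd _ (by fun_prop)).symm
  have hmid := hsnd.symm.trans
    (GroupEntropy.map_prod_prod_fst_snd_fst (μ := P.map X) (fun p => p.2) (by fun_prop)).symm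
  have hlast := hsnd.symm.trans
    (GroupEntropy.map_prod_prod_fst_snd_snd (μ := P.map X) (fun p => p.2) (by fun_prop)).symm
  have hac : P.map X ≪ ν := hfin.hasPDF.absolutelyContinuous'
  have triangle := GroupEntropy.entropy_sub_add_entropy_le hac hac
    (hfin_sub.congr (by fun_prop) hsub13) (hfin.congr (by fun_prop) hmid)
    (hfin_add.congr (by fun_prop) hadd12) (hfin_add.congr (by fun_prop) hadd23)
  rw [← GroupEntropy.entropy_congr hsub13, ← GroupEntropy.entropy_congr hmid,
    ← GroupEntropy.entropy_congr hadd12, ← GroupEntropy.entropy_congr hadd23] at triangle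
  have submod := GroupEntropy.entropy_add_add_entropy_le
    (hfin_add.congr (by fun_prop) hadd12) (hfin.congr (by fun_prop) hlast)
    (hfin_sub.congr (by fun_prop) hsub13) (hfin_sub.congr (by fun_prop) hsub23)
  rw [← GroupEntropy.entropy_congr hadd12, ← GroupEntropy.entropy_congr hlast,
    ← GroupEntropy.entropy_congr hsub13, ← GroupEntropy.entropy_congr hsub23] at submod
  have ratio (a b : ℝ) (h₁ : 1 / 2 * b ≤ a) (h₂ : a ≤ 2 * b) (hb : b ≠ 0) :
      a / b ∈ Set.Icc (1 / 2 : ℝ) 2 := by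
    -- The bounds give b / 2 ≤ 2 * b, which forces b ≥ 0.
    have hb' : 0 < b := lt_of_le_of_ne (by linarith) hb.symm
    exact ⟨(le_div_iff₀ hb').2 h₁, (div_le_iff₀ hb').2 h₂⟩
  rw [hdiv_neg, hdiv]
  refine ⟨rfl, rfl, ?lower, ?upper, ratio _ _ ?lower ?upper, ratio _ _ ?lower ?upper⟩
  -- The lower bound is `triangle`, the upper bound is `submod`.
  all_goals linarith
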